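/- Let $E$ be a complex Banach space and let $(e^{tD})_{t\in\mathbb{R}}$ be a strongly continuous one-parameter group of linear isometries of $E$ with infinitesimal generator $D$, that is, $Df=\lim_{t\to 0}t^{-1}(e^{tD}f-f)$ in norm, on the domain of all $f\in E$ for which the limit exists. For $\sigma>0$ let $\mathbf{B}_\sigma(D)$ be the set of all $f\in E$ which lie in the domain of $D^k$ for every $k\in\mathbb{N}$ and satisfy $\|D^kf\|\le\sigma^k\|f\|$ for every $k\in\mathbb{N}$. Let $\operatorname{sinc} w=\frac{\sin \pi w}{\pi w}$ for $w\in\mathbb{C}\setminus\{0\}$ and $\operatorname{sinc}0=1$. Let $\sigma>0$ and $f\in\mathbf{B}_\sigma(D)$. Then the series $e^{zD}f:=\sum_{r=0}^\infty \frac{z^r}{r!}D^rf$ converges in $E$ for every $z\in\mathbb{C}$ and defines an entire $E$-valued function of $z$ that coincides for real $z=t$ with the orbit $t\mapsto e^{tD}f$ of the group, and for every $z\in\mathbb{C}$ $$ e^{zD}f=z\,\operatorname{sinc}\!\left(\frac{\sigma z}{\pi}\right)Df+\operatorname{sinc}\!\left(\frac{\sigma z}{\pi}\right)f+\sum_{k\in\mathbb{Z}\setminus\{0\}}\frac{\sigma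 z}{k\pi}\,\operatorname{sinc}\!\left(\frac{\sigma z}{\pi}-k\right)e^{\frac{k\pi}{\sigma}D}f, $$ where the series converges (unconditionally) in the norm of $E$. -/

import Mathlib

open Filter Topology

noncomputable section

/-- A strongly continuous one-parameter group of linear isometries `T t = e^{tD}`, `t : ℝ`, of a
complex normed space `E`. -/
structure IsometryGroup (E : Type*) [NormedAddCommGroup E] [NormedSpace ℂ E] where
  toFun : ℝ → E →L[ℂ] E
  map_zero : toFun 0 = ContinuousLinearMap.id ℂ E
  map_add : ∀ s t : ℝ, toFun (s + t) = (toFun s).comp (toFun t)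
  norm_map : ∀ (t : ℝ) (f : E), ‖toFun t f‖ = ‖f‖
  continuous_orbit : ∀ f : E, Continuous fun t : ℝ => toFun t f

namespace IsometryGroup

variable {E : Type*} [NormedAddCommGroup E] [NormedSpace ℂ E]

/-- `g` is the derivative at `t = 0` of the orbit `t ↦ T t f`. -/
def HasGenerator (T : IsometryGroup E) (f g : E) : Prop :=
  Tendsto (fun t : ℝ => ((t : ℂ)⁻¹) • (T.toFun t f - f)) (𝓝[≠] 0) (𝓝 g)

theorem HasGenerator.add {T : IsometryGroup E} {f₁ f₂ g₁ g₂ : E}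
    (h₁ : T.HasGenerator f₁ g₁) (h₂ : T.HasGenerator f₂ g₂) :
    T.HasGenerator (f₁ + f₂) (g₁ + g₂) := by
  refine (Tendsto.add h₁ h₂).congr fun t => ?_
  rw [← smul_add, _root_.map_add, add_sub_add_comm]

theorem HasGenerator.smul {T : IsometryGroup E} {f g : E} (c : ℂ)
    (h : T.HasGenerator f g) : T.HasGenerator (c • f) (c • g) := by
  refine (Tendsto.const_smul h c).congr fun t => ?_
  rw [map_smul, ← smul_sub, smul_comm]

theorem HasGenerator.zero (T : IsometryGroup E) : T.HasGenerator 0 0 := by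
  simp [HasGenerator]

theorem HasGenerator.unique {T : IsometryGroup E} {f g₁ g₂ : E}
    (h₁ : T.HasGenerator f g₁) (h₂ : T.HasGenerator f g₂) : g₁ = g₂ :=
  tendsto_nhds_unique h₁ h₂

/-- The infinitesimal generator `D` of the group, as an unbounded operator: its domain consists
of all `f` for which `(T t f - f) / t` converges in norm as `t → 0`, and `D f` is the limit. -/
def generator (T : IsometryGroup E) : E →ₗ.[ℂ] E where
  domain :=
    { carrier := {f | ∃ g, T.HasGenerator f g}
      add_mem' := fun ⟨g₁, h₁⟩ ⟨g₂, h₂⟩ => ⟨g₁ + g₂, h₁.add h₂⟩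
      zero_mem' := ⟨0, HasGenerator.zero T⟩
      smul_mem' := fun c _ ⟨g, h⟩ => ⟨c • g, h.smul c⟩ }
  toFun :=
    { toFun := fun f => Classical.choose f.2
      map_add' := fun f₁ f₂ => (Classical.choose_spec (f₁ + f₂).2).unique
        ((Classical.choose_spec f₁.2).add (Classical.choose_spec f₂.2))
      map_smul' := fun c f => (Classical.choose_spec (c • f).2).unique
        ((Classical.choose_spec f.2).smul c) }

theorem generator_spec (T : IsometryGroup E) (f : T.generator.domain) :
    T.HasGenerator (f : E) (T.generator f) :=
  Classical.choose_spec f.2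

end IsometryGroup

namespace UnboundedOp

variable {E : Type*} [NormedAddCommGroup E] [NormedSpace ℂ E]

/-- The composition `A ∘ B` of unbounded operators, on the domain of all `f ∈ dom B` with
`B f ∈ dom A`. -/
def comp (A B : E →ₗ.[ℂ] E) : E →ₗ.[ℂ] E where
  domain :=
    { carrier := {f | ∃ h : f ∈ B.domain, B ⟨f, h⟩ ∈ A.domain}
      add_mem' := by
        rintro f₁ f₂ ⟨h₁, k₁⟩ ⟨h₂, k₂⟩
        refine ⟨B.domain.add_mem h₁ h₂, ?_⟩
        have h := A.domain.add_mem k₁ k₂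
        rwa [← LinearPMap.map_add] at h
      zero_mem' := ⟨B.domain.zero_mem, by
        have h := LinearPMap.map_zero B
        change B (0 : B.domain) ∈ A.domain
        rw [h]
        exact A.domain.zero_mem⟩
      smul_mem' := by
        rintro c f ⟨h₁, k₁⟩
        refine ⟨B.domain.smul_mem c h₁, ?_⟩
        have h := A.domain.smul_mem c k₁
        rwa [← LinearPMap.map_smul] at h }
  toFun :=
    { toFun := fun f => A ⟨B ⟨f.1, f.2.1⟩, f.2.2⟩
      map_add' := fun f₁ f₂ => by
        rw [← LinearPMap.map_add]
        congr 1
        apply Subtype.ext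
        exact LinearPMap.map_add B ⟨f₁.1, f₁.2.1⟩ ⟨f₂.1, f₂.2.1⟩
      map_smul' := fun c f => by
        rw [RingHom.id_apply, ← LinearPMap.map_smul]
        congr 1
        apply Subtype.ext
        exact LinearPMap.map_smul B c ⟨f.1, f.2.1⟩ }

/-- The power `D ^ k` of an unbounded operator, with its natural domain. -/
def pow (D : E →ₗ.[ℂ] E) : ℕ → (E →ₗ.[ℂ] E)
  | 0 => ⟨⊤, (⊤ : Submodule ℂ E).subtype⟩
  | k + 1 => comp D (pow D k)

/-- `𝒟^∞`, the intersection of the domains of all the powers of `D`. -/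
def smoothDomain (D : E →ₗ.[ℂ] E) : Submodule ℂ E := ⨅ k : ℕ, (pow D k).domain

theorem mem_pow_domain {D : E →ₗ.[ℂ] E} {f : E} (h : f ∈ smoothDomain D) (k : ℕ) :
    f ∈ (pow D k).domain :=
  (Submodule.mem_iInf _).1 h k

theorem mem_domain {D : E →ₗ.[ℂ] E} {f : E} (h : f ∈ smoothDomain D) : f ∈ D.domain :=
  (mem_pow_domain h 1).2

/-- `D ^ k f` for `f ∈ 𝒟^∞`. -/
def iter (D : E →ₗ.[ℂ] E) (k : ℕ) (f : smoothDomain D) : E :=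
  pow D k ⟨f.1, mem_pow_domain f.2 k⟩

/-- The Bernstein space `𝐁_σ(D)`. -/
def bernsteinSpace (D : E →ₗ.[ℂ] E) (σ : ℝ) : Set E :=
  {f | ∃ h : f ∈ smoothDomain D, ∀ k : ℕ, ‖iter D k ⟨f, h⟩‖ ≤ σ ^ k * ‖f‖}

theorem bernsteinSpace_subset {D : E →ₗ.[ℂ] E} {σ : ℝ} {f : E} (hf : f ∈ bernsteinSpace D σ) :
    f ∈ smoothDomain D :=
  hf.1

/-- The `r`-th term `z ^ r D ^ r f / r!` of the exponential series. -/
def expTerm (D : E →ₗ.[ℂ] E) (z : ℂ) (f : smoothDomain D) (r : ℕ) : E :=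
  (z ^ r / (r.factorial : ℂ)) • iter D r f

/-- `e^{zD} f = ∑ z ^ r D ^ r f / r!`, for complex `z`. -/
def cexp (D : E →ₗ.[ℂ] E) (z : ℂ) (f : smoothDomain D) : E :=
  ∑' r : ℕ, expTerm D z f r

end UnboundedOp

/-- The normalized complex sinc function, `sin (π z) / (π z)` with value `1` at `0`. -/
def csinc (z : ℂ) : ℂ :=
  if z = 0 then 1 else Complex.sin (Real.pi * z) / (Real.pi * z)

end

/-! The Bernstein inequalities make `F z = e^{zD} f` an entire function of exponential type `σ`. On
the real line `F` is the orbit of `f`, so its norm is `‖f‖` there, and Phragmén–Lindelöf gives `‖F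
z‖ ≤ ‖f‖ exp (σ |Im z|)` (`norm_cexp_le_exp_abs_im`). After rescaling to type `π`, the formula is
the Valiron–Tschakaloff sampling formula for vector-valued functions (`valiron_tschakaloff`).

For that formula, put `R w = (G w - sinc w • G 0) / w - sinc w • G' 0 - ∑ (sinc (w - k) / k) • G k`,
the sum being over `k ≠ 0`. It vanishes at every integer and is `O(exp (π |Im w|) / √(1 + |w|))`;
the decay of the series is `exists_tsum_kernel_le`. Hence `R w = sin (π w) • H w` with `H` entire.
Lower bounds for the sine and the maximum principle give `H → 0` at infinity, so `H = 0` by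
Liouville (`eq_zero_of_vanish_on_int`). -/

/-! ### Division by the sine and a uniqueness theorem for entire functions -/

section EntireFunctions

variable {E : Type*} [NormedAddCommGroup E] [NormedSpace ℂ E]

/-- An entire function that vanishes at all zeros of an entire scalar function with simple zeros
is divisible by it. -/
theorem exists_entire_smul_eq [CompleteSpace E] {R : ℂ → E} {s : ℂ → ℂ} (hR : Differentiable ℂ R)
    (hs : Differentiable ℂ s) (h : ∀ w, s w = 0 → R w = 0 ∧ deriv s w ≠ 0) :
    ∃ H : ℂ → E, Differentiable ℂ H ∧ ∀ w, R w = s w • H w := by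
  classical
  refine ⟨fun w => if s w = 0 then (deriv s w)⁻¹ • deriv R w else (s w)⁻¹ • R w, ?_, ?_⟩
  · intro c
    by_cases hc : s c = 0
    · obtain ⟨hRc, hdc⟩ := h c hc
      have hds : Differentiable ℂ (dslope s c) := fun w =>
        ((Complex.differentiableOn_dslope univ_mem).2 hs.differentiableOn).differentiableAt univ_mem
      have hdR : Differentiable ℂ (dslope R c) := fun w =>
        ((Complex.differentiableOn_dslope univ_mem).2 hR.differentiableOn).differentiableAt univ_mem
      have hne : dslope s c c ≠ 0 := by rwa [dslope_same]
      -- Near a zero `c` the factors `w - c` cancel, and the quotient of the two divided differences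
      -- has a denominator that does not vanish at `c`.
      have hq : DifferentiableAt ℂ (fun w => (dslope s c w)⁻¹ • dslope R c w) c :=
        (hds.differentiableAt.inv hne).smul hdR.differentiableAt
      refine hq.congr_of_eventuallyEq ?_
      filter_upwards [hds.continuous.continuousAt.eventually_ne hne] with w hw
      rcases eq_or_ne w c with rfl | hwc
      · simp [hc, dslope_same]
      · have hsw : s w = (w - c) * dslope s c w := by
          have := sub_smul_dslope s c w
          rw [hc, sub_zero, smul_eq_mul] at this
          exact this.symm
        have hRw : R w = (w - c) • dslope R c w := by
          have := sub_smul_dslope R c w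
          rw [hRc, sub_zero] at this
          exact this.symm
        have hwc' : w - c ≠ 0 := sub_ne_zero.2 hwc
        have : s w ≠ 0 := by rw [hsw]; exact mul_ne_zero hwc' hw
        rw [if_neg this, hRw, hsw, smul_smul]
        congr 1
        field_simp
    · refine ((hs.differentiableAt.inv hc).smul hR.differentiableAt).congr_of_eventuallyEq ?_
      filter_upwards [hs.continuous.continuousAt.eventually_ne hc] with w hw
      simp [hw]
  · intro w
    by_cases hw : s w = 0
    · simp [hw, (h w hw).1]
    · simp [hw, smul_smul]

theorem Complex.norm_sin_sq (w : ℂ) :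
    ‖Complex.sin w‖ ^ 2 = Real.sin w.re ^ 2 + Real.sinh w.im ^ 2 := by
  have h1 : (Complex.sin w).re = Real.sin w.re * Real.cosh w.im := by
    conv_lhs => rw [Complex.sin_eq w]
    simp [← Complex.ofReal_sin, ← Complex.ofReal_cos, ← Complex.ofReal_sinh, ← Complex.ofReal_cosh]
  have h2 : (Complex.sin w).im = Real.cos w.re * Real.sinh w.im := by
    conv_lhs => rw [Complex.sin_eq w]
    simp [← Complex.ofReal_sin, ← Complex.ofReal_cos, ← Complex.ofReal_sinh, ← Complex.ofReal_cosh]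
  rw [Complex.sq_norm, Complex.normSq_apply, h1, h2]
  have e1 := Real.sin_sq_add_cos_sq w.re
  have e2 := Real.cosh_sq w.im
  linear_combination (Real.sin w.re ^ 2) * e2 + (Real.sinh w.im ^ 2) * e1

theorem Complex.norm_sin_le_exp_abs_im (w : ℂ) : ‖Complex.sin w‖ ≤ Real.exp |w.im| := by
  have h := Complex.norm_sin_sq w
  have h1 := Real.sin_sq_le_one w.re
  have h2 := Real.cosh_sq w.im
  have h3 : ‖Complex.sin w‖ ≤ Real.cosh w.im :=
    abs_le_of_sq_le_sq' (by linarith) (Real.cosh_pos _).le |>.2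
  have h4 : Real.cosh w.im ≤ Real.exp |w.im| := by
    rw [← Real.cosh_abs, Real.cosh_eq]
    have : Real.exp (-|w.im|) ≤ Real.exp |w.im| :=
      Real.exp_le_exp.2 (by linarith [abs_nonneg w.im])
    linarith
  exact h3.trans h4

/-- The sine dominates `sinh |Im w|`, which is comparable to the exponential away from the real
axis. This serves the horizontal sides of the rectangles below. -/
theorem Complex.exp_abs_im_le_of_one_le {w : ℂ} (h : 1 ≤ |w.im|) :
    Real.exp |w.im| ≤ 4 * ‖Complex.sin w‖ := by
  have h0 := Complex.norm_sin_sq w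
  have h1 : Real.sinh |w.im| ≤ ‖Complex.sin w‖ := by
    refine abs_le_of_sq_le_sq' ?_ (norm_nonneg _) |>.2
    rw [h0, ← Real.abs_sinh, sq_abs]
    nlinarith [sq_nonneg (Real.sin w.re)]
  have h2 : Real.exp (-|w.im|) ≤ 1 / 2 := by
    rw [Real.exp_neg]
    have : (2 : ℝ) ≤ Real.exp |w.im| := by linarith [Real.add_one_le_exp |w.im|]
    rw [one_div]
    exact inv_anti₀ (by norm_num) this
  have h3 : (2 : ℝ) ≤ Real.exp |w.im| := by linarith [Real.add_one_le_exp |w.im|]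
  rw [Real.sinh_eq] at h1
  linarith

/-- On the vertical lines midway between zeros of the sine, `|sin w|` equals `cosh (Im w)`. This
serves the vertical sides of the rectangles. -/
theorem Complex.exp_abs_im_le_of_cos_eq_zero {w : ℂ} (h : Real.cos w.re = 0) :
    Real.exp |w.im| ≤ 4 * ‖Complex.sin w‖ := by
  have h0 := Complex.norm_sin_sq w
  have h1 : Real.cosh |w.im| ≤ ‖Complex.sin w‖ := by
    refine abs_le_of_sq_le_sq' ?_ (norm_nonneg _) |>.2
    rw [h0, Real.cosh_abs, Real.cosh_sq]
    have := Real.sin_sq_add_cos_sq w.re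
    rw [h] at this
    linarith
  rw [Real.cosh_eq] at h1
  linarith [Real.exp_pos |w.im|, Real.exp_pos (-|w.im|)]

theorem Complex.sin_pi_mul_eq_zero_iff {w : ℂ} :
    Complex.sin (Real.pi * w) = 0 ↔ ∃ k : ℤ, w = k := by
  rw [Complex.sin_eq_zero_iff]
  refine exists_congr fun k => ⟨fun h => ?_, fun h => by rw [h, mul_comm]⟩
  have : (Real.pi : ℂ) ≠ 0 := by exact_mod_cast Real.pi_ne_zero
  rw [mul_comm] at h
  exact mul_right_cancel₀ this h

theorem Complex.deriv_sin_pi_mul (w : ℂ) :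
    deriv (fun w : ℂ => Complex.sin (Real.pi * w)) w = Complex.cos (Real.pi * w) * Real.pi := by
  have h : HasDerivAt (fun w : ℂ => (Real.pi : ℂ) * w) Real.pi w := by
    simpa using (hasDerivAt_id w).const_mul (Real.pi : ℂ)
  exact h.csin.deriv

/-- An entire function that vanishes at the integers and decays relative to `exp (π |Im w|)` is
zero. -/
theorem eq_zero_of_vanish_on_int [CompleteSpace E] {R : ℂ → E} (hR : Differentiable ℂ R)
    (hz : ∀ k : ℤ, R k = 0) {A : ℝ}
    (hA : ∀ w, ‖R w‖ ≤ A * Real.exp (Real.pi * |w.im|) / √(1 + ‖w‖)) (w : ℂ) : R w = 0 := by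
  have hA0 : 0 ≤ A := by simpa using (norm_nonneg _).trans (hA 0)
  obtain ⟨H, hH, hRH⟩ := exists_entire_smul_eq (s := fun w => Complex.sin (Real.pi * w)) hR
    (by fun_prop) (by
      intro w hw
      have hw' := hw
      obtain ⟨k, rfl⟩ := Complex.sin_pi_mul_eq_zero_iff.1 hw
      refine ⟨hz k, ?_⟩
      rw [Complex.deriv_sin_pi_mul]
      refine mul_ne_zero (fun hc => ?_) (by exact_mod_cast Real.pi_ne_zero)
      have := Complex.sin_sq_add_cos_sq (Real.pi * (k : ℂ))
      rw [hw', hc] at this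
      norm_num at this)
  have im_eq (w : ℂ) : ((Real.pi : ℂ) * w).im = Real.pi * w.im := by simp
  have re_eq (w : ℂ) : ((Real.pi : ℂ) * w).re = Real.pi * w.re := by simp
  have abs_im_eq (w : ℂ) : |((Real.pi : ℂ) * w).im| = Real.pi * |w.im| := by
    rw [im_eq, abs_mul, abs_of_pos Real.pi_pos]
  have good (w : ℂ) (h : Real.exp |((Real.pi : ℂ) * w).im| ≤ 4 * ‖Complex.sin (Real.pi * w)‖) :
      ‖H w‖ ≤ 4 * A / √(1 + ‖w‖) := by
    rw [abs_im_eq] at h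
    have h1 := hA w
    rw [hRH w, norm_smul] at h1
    have he := Real.exp_pos (Real.pi * |w.im|)
    have hs : 0 < √(1 + ‖w‖) := Real.sqrt_pos.2 (by positivity)
    have h2 : Real.exp (Real.pi * |w.im|) * ‖H w‖ ≤
        Real.exp (Real.pi * |w.im|) * (4 * A / √(1 + ‖w‖)) := by
      calc _ ≤ 4 * ‖Complex.sin (Real.pi * w)‖ * ‖H w‖ := by gcongr
        _ ≤ 4 * (A * Real.exp (Real.pi * |w.im|) / √(1 + ‖w‖)) := by linarith
        _ = _ := by ring
    exact le_of_mul_le_mul_left h2 he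
  have bound (w : ℂ) : ‖H w‖ ≤ 8 * A / √(1 + ‖w‖) := by
    have hs : 0 < √(1 + ‖w‖) := Real.sqrt_pos.2 (by positivity)
    by_cases hw : 1 ≤ |w.im|
    · refine (good w (Complex.exp_abs_im_le_of_one_le ?_)).trans ?_
      · rw [abs_im_eq]
        nlinarith [Real.pi_gt_three]
      · gcongr
        norm_num
    · push Not at hw
      set n : ℤ := round w.re
      have hn : |w.re - n| ≤ 1 / 2 := abs_sub_round w.re
      obtain ⟨hn1, hn2⟩ := abs_le.1 hn
      obtain ⟨hw1, hw2⟩ := abs_lt.1 hw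
      have hab : (n : ℝ) - 1 / 2 < n + 1 / 2 := by linarith
      have hcd : (-1 : ℝ) < 1 := by norm_num
      -- Near the real axis the sine may be small, so the bound is taken from the boundary of a
      -- rectangle around the nearest integer. Boundary points lie within distance 3 of `w`, which
      -- costs a factor 2 in the square root: hence `8 * A` in place of `4 * A`.
      refine Complex.norm_le_of_forall_mem_frontier_norm_le
        (U := Set.Ioo ((n : ℝ) - 1 / 2) (n + 1 / 2) ×ℂ Set.Ioo (-1 : ℝ) 1)
        ((Metric.isBounded_Ioo _ _).reProdIm (Metric.isBounded_Ioo _ _)) hH.diffContOnCl ?_ ?_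
      · intro ζ hζ
        have hmem : ζ.re ∈ Set.Icc ((n : ℝ) - 1 / 2) (n + 1 / 2) ∧ ζ.im ∈ Set.Icc (-1 : ℝ) 1 := by
          have := frontier_subset_closure hζ
          rwa [Complex.closure_reProdIm, closure_Ioo hab.ne, closure_Ioo hcd.ne,
            Complex.mem_reProdIm] at this
        obtain ⟨⟨a1, a2⟩, b1, b2⟩ := hmem
        have hdist : ‖w - ζ‖ ≤ 3 := by
          refine (Complex.norm_le_abs_re_add_abs_im _).trans ?_
          have h1 : |(w - ζ).re| ≤ 1 := by
            rw [Complex.sub_re, abs_le]; constructor <;> linarith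
          have h2 : |(w - ζ).im| ≤ 2 := by
            rw [Complex.sub_im, abs_le]; constructor <;> linarith
          linarith
        have hnorm : 1 + ‖w‖ ≤ 2 ^ 2 * (1 + ‖ζ‖) := by
          have := norm_le_norm_add_norm_sub' w ζ
          linarith [norm_nonneg ζ]
        have hsq : √(1 + ‖w‖) ≤ 2 * √(1 + ‖ζ‖) := by
          calc √(1 + ‖w‖) ≤ √(2 ^ 2 * (1 + ‖ζ‖)) := Real.sqrt_le_sqrt hnorm
            _ = 2 * √(1 + ‖ζ‖) := by
              rw [Real.sqrt_mul (by norm_num), Real.sqrt_sq (by norm_num)]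
        have hg : ‖H ζ‖ ≤ 4 * A / √(1 + ‖ζ‖) := by
          apply good
          rw [Complex.frontier_reProdIm, frontier_Ioo hab, frontier_Ioo hcd] at hζ
          rcases hζ with hζ | hζ
          · apply Complex.exp_abs_im_le_of_one_le
            have : |ζ.im| = 1 := by
              rcases hζ.2 with h | h
              · rw [h]; norm_num
              · rw [Set.mem_singleton_iff.1 h]; norm_num
            rw [abs_im_eq, this]
            linarith [Real.pi_gt_three]
          · apply Complex.exp_abs_im_le_of_cos_eq_zero
            rw [re_eq, Real.cos_eq_zero_iff]
            rcases hζ.1 with h | h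
            · exact ⟨n - 1, by rw [h]; push_cast; ring⟩
            · exact ⟨n, by rw [Set.mem_singleton_iff.1 h]; ring⟩
        refine hg.trans ?_
        have hs' : 0 < √(1 + ‖ζ‖) := Real.sqrt_pos.2 (by positivity)
        rw [div_le_div_iff₀ hs' hs]
        nlinarith
      · rw [Complex.closure_reProdIm, closure_Ioo hab.ne, closure_Ioo hcd.ne,
          Complex.mem_reProdIm]
        exact ⟨⟨by linarith, by linarith⟩, by linarith, by linarith⟩
  have hlim : Tendsto H (cocompact ℂ) (𝓝 0) := by
    refine squeeze_zero_norm bound ?_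
    refine Tendsto.div_atTop tendsto_const_nhds (Real.tendsto_sqrt_atTop.comp ?_)
    exact tendsto_atTop_add_const_left _ _ (tendsto_norm_cocompact_atTop (E := ℂ))
  rw [hRH w, hH.apply_eq_of_tendsto_cocompact w hlim, smul_zero]

/-- Difference quotients at `0` of functions bounded by `exp (π |Im w|)` gain a decay of order
one. -/
theorem exists_norm_dslope_le [CompleteSpace E] {h : ℂ → E} (hh : Differentiable ℂ h) {B : ℝ}
    (hB : ∀ w, ‖h w‖ ≤ B * Real.exp (Real.pi * |w.im|)) :
    ∃ C, 0 ≤ C ∧ ∀ w, ‖dslope h 0 w‖ ≤ C * Real.exp (Real.pi * |w.im|) / (1 + ‖w‖) := by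
  have hd : Differentiable ℂ (dslope h 0) := fun w =>
    ((Complex.differentiableOn_dslope univ_mem).2 hh.differentiableOn).differentiableAt univ_mem
  have hB0 : 0 ≤ B := by simpa using (norm_nonneg _).trans (hB 0)
  -- `K` controls the unit disc by compactness; outside it the division by `w` gives the decay.
  obtain ⟨K, hK⟩ := (isCompact_closedBall (0 : ℂ) 1).exists_bound_of_continuousOn
    hd.continuous.continuousOn
  have hK0 : 0 ≤ K := (norm_nonneg _).trans (hK 0 (by simp))
  refine ⟨2 * K + 4 * B, by positivity, fun w => ?_⟩
  have hone : 1 ≤ Real.exp (Real.pi * |w.im|) := Real.one_le_exp (by positivity)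
  set e := Real.exp (Real.pi * |w.im|)
  have hw0 := norm_nonneg w
  rw [le_div_iff₀ (by positivity)]
  rcases le_total ‖w‖ 1 with hw | hw
  · have h1 := hK w (by simpa using hw)
    calc ‖dslope h 0 w‖ * (1 + ‖w‖) ≤ K * 2 := by
          gcongr; linarith
      _ ≤ (2 * K + 4 * B) * 1 := by linarith
      _ ≤ _ := by gcongr
  · have hne : w ≠ 0 := by rintro rfl; norm_num at hw
    have hpos : 0 < ‖w‖ := by linarith
    have hb0 : ‖h 0‖ ≤ B := by simpa using hB 0
    have h1 : ‖w‖ * ‖dslope h 0 w‖ ≤ 2 * B * e := by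
      have := sub_smul_dslope h 0 w
      rw [sub_zero] at this
      rw [← norm_smul, this]
      calc ‖h w - h 0‖ ≤ ‖h w‖ + ‖h 0‖ := norm_sub_le _ _
        _ ≤ B * e + B * 1 := by rw [mul_one]; exact add_le_add (hB w) hb0
        _ ≤ B * e + B * e := by gcongr
        _ = _ := by ring
    have h2 : ‖dslope h 0 w‖ ≤ ‖w‖ * ‖dslope h 0 w‖ := le_mul_of_one_le_left (norm_nonneg _) hw
    have : 0 ≤ K * e := by positivity
    nlinarith

end EntireFunctions

/-! ### Decay of the kernel series -/

section Kernel

/-- The larger of `a` and `b` is at least `W / 2`; half a power of it pays for `√W`, and the other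
half is at least the square root of the smaller. -/
theorem inv_mul_le_of_le_add {a b W : ℝ} (ha : 0 < a) (hb : 0 < b) (hW : 0 < W) (h : W ≤ a + b) :
    (a * b)⁻¹ ≤ 2 / √W * ((a * √a)⁻¹ + (b * √b)⁻¹) := by
  wlog hab : b ≤ a generalizing a b
  · rw [mul_comm a b, add_comm (a * √a)⁻¹]
    exact this hb ha (by linarith) (by linarith)
  have hsa := Real.sqrt_pos.2 ha
  have hsb := Real.sqrt_pos.2 hb
  have hsW := Real.sqrt_pos.2 hW
  have h1 : √W ≤ 2 * √a := by
    rw [Real.sqrt_le_left (by positivity), mul_pow, Real.sq_sqrt ha.le]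
    linarith
  have h2 : √b ≤ √a := Real.sqrt_le_sqrt hab
  have h3 : (a * b)⁻¹ ≤ 2 / √W * (b * √b)⁻¹ := by
    rw [← one_div, ← one_div, div_mul_div_comm, mul_one, div_le_div_iff₀ (by positivity)
      (by positivity), one_mul]
    calc √W * (b * √b) ≤ 2 * √a * (b * √a) := by gcongr
      _ = 2 * ((√a * √a) * b) := by ring
      _ = 2 * (a * b) := by rw [Real.mul_self_sqrt ha.le]
  refine h3.trans ?_
  gcongr
  exact le_add_of_nonneg_left (by positivity)

theorem summable_int_inv_mul_sqrt :
    Summable fun k : ℤ => ((1 + |(k : ℝ)|) * √(1 + |(k : ℝ)|))⁻¹ := by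
  -- The shift by `1 / 2` keeps the comparison series with exponent `3 / 2` free of a zero
  -- denominator.
  refine Summable.of_nonneg_of_le (fun k => by positivity) (fun k => ?_)
    ((Real.summable_one_div_int_add_rpow (1 / 2) (3 / 2)).2 (by norm_num))
  have hne : (k : ℝ) + 1 / 2 ≠ 0 := by
    intro h
    have : (2 * k + 1 : ℝ) = 0 := by linarith
    have : (2 * k + 1 : ℤ) = 0 := by exact_mod_cast this
    omega
  have hpos := abs_pos.2 hne
  have hle : |(k : ℝ) + 1 / 2| ≤ 1 + |(k : ℝ)| := by
    refine (abs_add_le _ _).trans ?_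
    rw [abs_of_pos (by norm_num : (0 : ℝ) < 1 / 2)]
    linarith
  have heq : |(k : ℝ) + 1 / 2| ^ (3 / 2 : ℝ) = |(k : ℝ) + 1 / 2| * √|(k : ℝ) + 1 / 2| := by
    rw [Real.sqrt_eq_rpow, ← Real.rpow_one_add' hpos.le (by norm_num)]
    norm_num
  rw [heq, one_div]
  gcongr

/-- The splitting `1 + ‖w‖ ≤ (1 + |k|) + (1 + ‖w - k‖)` reduces the sum to two series with exponent
`3 / 2`. With `n` the integer nearest to `Re w`, the second is dominated by a translate of the
first, so its sum does not depend on `w`. -/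
theorem exists_tsum_kernel_le : ∃ S : ℝ, ∀ w : ℂ,
    Summable (fun k : ℤ => ((1 + |(k : ℝ)|) * (1 + ‖w - k‖))⁻¹) ∧
    ∑' k : ℤ, ((1 + |(k : ℝ)|) * (1 + ‖w - k‖))⁻¹ ≤ S / √(1 + ‖w‖) := by
  set φ : ℤ → ℝ := fun k => ((1 + |(k : ℝ)|) * √(1 + |(k : ℝ)|))⁻¹ with hφ
  have hsum : Summable φ := summable_int_inv_mul_sqrt
  refine ⟨2 * (∑' k, φ k + 4 * ∑' k, φ k), fun w => ?_⟩
  set n : ℤ := round w.re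
  have hshift : Summable fun k : ℤ => φ (k - n) := (Equiv.subRight n).summable_iff.2 hsum
  have hshift' : ∑' k : ℤ, φ (k - n) = ∑' k, φ k := (Equiv.subRight n).tsum_eq φ
  have hle (k : ℤ) : ((1 + |(k : ℝ)|) * (1 + ‖w - k‖))⁻¹ ≤
      2 / √(1 + ‖w‖) * (φ k + 4 * φ (k - n)) := by
    refine (inv_mul_le_of_le_add (W := 1 + ‖w‖) (by positivity) (by positivity) (by positivity)
      ?_).trans ?_
    · have := norm_le_norm_add_norm_sub' w (k : ℂ)
      rw [Complex.norm_intCast] at this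
      linarith
    · gcongr
      set x : ℝ := 1 + |((k - n : ℤ) : ℝ)| with hx
      have hx0 : 0 < x := by positivity
      have hxb : x ≤ 2 * (1 + ‖w - k‖) := by
        have h1 : |w.re - k| ≤ ‖w - k‖ := by
          have := Complex.abs_re_le_norm (w - k)
          simpa using this
        have h2 : |w.re - n| ≤ 1 / 2 := abs_sub_round w.re
        have h3 : |((k - n : ℤ) : ℝ)| ≤ |w.re - k| + |w.re - n| := by
          push_cast
          rw [show (k : ℝ) - n = (w.re - n) - (w.re - k) by ring, add_comm]
          exact abs_sub _ _
        have := norm_nonneg (w - k)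
        linarith
      have hsx : √x ≤ 2 * √(1 + ‖w - k‖) := by
        rw [Real.sqrt_le_left (by positivity), mul_pow, Real.sq_sqrt (by positivity)]
        have := norm_nonneg (w - k)
        linarith
      have hsx0 := Real.sqrt_pos.2 hx0
      -- The 4 is a factor 2 from `hxb` times a factor 2 from `hsx`.
      change _ ≤ 4 * (x * √x)⁻¹
      rw [← one_div, ← one_div, mul_one_div, div_le_div_iff₀ (by positivity) (by positivity),
        one_mul]
      calc x * √x ≤ (2 * (1 + ‖w - k‖)) * (2 * √(1 + ‖w - k‖)) := by gcongr
        _ = _ := by ring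
  have hs : Summable fun k : ℤ => 2 / √(1 + ‖w‖) * (φ k + 4 * φ (k - n)) :=
    (hsum.add (hshift.mul_left 4)).mul_left _
  have hs' : Summable (fun k : ℤ => ((1 + |(k : ℝ)|) * (1 + ‖w - k‖))⁻¹) :=
    Summable.of_nonneg_of_le (fun k => by positivity) hle hs
  refine ⟨hs', (hs'.tsum_le_tsum hle hs).trans_eq ?_⟩
  rw [tsum_mul_left, hsum.tsum_add (hshift.mul_left 4), tsum_mul_left, hshift']
  ring

end Kernel

/-! ### The sinc function -/

section Csinc

theorem csinc_zero : csinc 0 = 1 := by simp [csinc]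

/-- In this form, sinc inherits both its entirety and its decay from general facts about divided
differences. -/
theorem csinc_eq_dslope : csinc = dslope (fun w : ℂ => Complex.sin (Real.pi * w) / Real.pi) 0 := by
  have hpi : (Real.pi : ℂ) ≠ 0 := by exact_mod_cast Real.pi_ne_zero
  funext w
  rcases eq_or_ne w 0 with rfl | hw
  · rw [dslope_same, csinc_zero, deriv_div_const, Complex.deriv_sin_pi_mul]
    simp [hpi]
  · rw [dslope_of_ne _ hw, slope_def_field, csinc, if_neg hw]
    simp
    field_simp

theorem differentiable_csinc : Differentiable ℂ csinc := by
  rw [csinc_eq_dslope]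
  have : Differentiable ℂ (fun w : ℂ => Complex.sin (Real.pi * w) / Real.pi) := by fun_prop
  exact fun w => ((Complex.differentiableOn_dslope univ_mem).2
    this.differentiableOn).differentiableAt univ_mem

theorem csinc_intCast {k : ℤ} (hk : k ≠ 0) : csinc k = 0 := by
  rw [csinc, if_neg (by exact_mod_cast hk), Complex.sin_pi_mul_eq_zero_iff.2 ⟨k, rfl⟩, zero_div]

theorem csinc_neg (w : ℂ) : csinc (-w) = csinc w := by
  simp [csinc, neg_div_neg_eq]

theorem deriv_csinc_zero : deriv csinc 0 = 0 := by
  have h := deriv_comp_neg csinc 0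
  simp only [csinc_neg, neg_zero] at h
  linear_combination h / 2

theorem exists_norm_csinc_le : ∃ C, 0 ≤ C ∧
    ∀ w, ‖csinc w‖ ≤ C * Real.exp (Real.pi * |w.im|) / (1 + ‖w‖) := by
  rw [csinc_eq_dslope]
  refine exists_norm_dslope_le (by fun_prop) (B := 1) fun w => ?_
  rw [norm_div, one_mul]
  have h := Complex.norm_sin_le_exp_abs_im (Real.pi * w)
  have h1 : |((Real.pi : ℂ) * w).im| = Real.pi * |w.im| := by
    simp [abs_mul, abs_of_pos Real.pi_pos]
  rw [h1] at h
  refine (div_le_self (norm_nonneg _) ?_).trans h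
  rw [Complex.norm_real, Real.norm_of_nonneg Real.pi_pos.le]
  linarith [Real.pi_gt_three]

end Csinc

/-! ### The Valiron–Tschakaloff formula -/

section Sampling

variable {E : Type*} [NormedAddCommGroup E] [NormedSpace ℂ E]

theorem norm_inv_intCast_le (k : ℤ) : ‖((k : ℂ))⁻¹‖ ≤ 2 * (1 + |(k : ℝ)|)⁻¹ := by
  rcases eq_or_ne k 0 with rfl | hk
  · simp
  · have h1 : (1 : ℝ) ≤ |(k : ℝ)| := by exact_mod_cast Int.one_le_abs hk
    rw [norm_inv, Complex.norm_intCast, ← one_div, ← div_eq_mul_inv,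
      div_le_div_iff₀ (by positivity) (by positivity)]
    linarith

/-- The Valiron–Tschakaloff sampling formula for entire functions bounded by a multiple of
`exp (π |Im w|)`. -/
theorem valiron_tschakaloff [CompleteSpace E] {G : ℂ → E} (hG : Differentiable ℂ G) {M : ℝ}
    (hM : ∀ w, ‖G w‖ ≤ M * Real.exp (Real.pi * |w.im|)) (w : ℂ) :
    Summable (fun k : ℤ => (csinc (w - k) * (k : ℂ)⁻¹) • G k) ∧
    G w = (w * csinc w) • deriv G 0 + csinc w • G 0 +
      w • ∑' k : ℤ, (csinc (w - k) * (k : ℂ)⁻¹) • G k := by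
  have hM0 : 0 ≤ M := by simpa using (norm_nonneg _).trans (hM 0)
  have hGk (k : ℤ) : ‖G k‖ ≤ M := by simpa using hM k
  obtain ⟨C, hC0, hC⟩ := exists_norm_csinc_le
  obtain ⟨S, hS⟩ := exists_tsum_kernel_le
  -- Since `0⁻¹ = 0`, the term at `k = 0` is zero and the sum over `ℤ` is the sum over nonzero
  -- integers.
  set q : ℤ → ℂ → E := fun k w => (csinc (w - k) * (k : ℂ)⁻¹) • G k
  have hq (k : ℤ) (w : ℂ) : ‖q k w‖ ≤ 2 * C * M * Real.exp (Real.pi * |w.im|) *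
      ((1 + |(k : ℝ)|) * (1 + ‖w - k‖))⁻¹ := by
    have h1 := hC (w - k)
    have h2 : (w - k).im = w.im := by simp
    rw [h2] at h1
    calc ‖q k w‖ = ‖csinc (w - k)‖ * ‖(k : ℂ)⁻¹‖ * ‖G k‖ := by rw [norm_smul, norm_mul]
      _ ≤ (C * Real.exp (Real.pi * |w.im|) / (1 + ‖w - k‖)) * (2 * (1 + |(k : ℝ)|)⁻¹) * M := by
        gcongr
        exacts [norm_inv_intCast_le k, hGk k]
      _ = _ := by rw [mul_inv]; ring
  have hqs (w : ℂ) : Summable fun k => ‖q k w‖ :=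
    Summable.of_nonneg_of_le (fun k => norm_nonneg _) (fun k => hq k w) ((hS w).1.mul_left _)
  have hqd (k : ℤ) : Differentiable ℂ (q k) := by
    refine Differentiable.smul_const (Differentiable.mul_const ?_ _) _
    exact differentiable_csinc.comp (differentiable_id.sub_const _)
  set Q : ℂ → E := fun w => ∑' k, q k w
  have hQd : Differentiable ℂ Q := by
    intro w₀
    have hmem : Metric.ball (0 : ℂ) (‖w₀‖ + 1) ∈ 𝓝 w₀ :=
      Metric.isOpen_ball.mem_nhds (by simp)
    refine DifferentiableOn.differentiableAt (s := Metric.ball (0 : ℂ) (‖w₀‖ + 1)) ?_ hmem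
    set r := ‖w₀‖ + 1
    refine Complex.differentiableOn_tsum_of_summable_norm
      (u := fun k : ℤ => 2 * C * M * Real.exp (Real.pi * r) * (1 + r) *
        ((1 + |(k : ℝ)|) * √(1 + |(k : ℝ)|))⁻¹)
      (summable_int_inv_mul_sqrt.mul_left _) (fun k => (hqd k).differentiableOn)
      Metric.isOpen_ball fun k w hw => ?_
    have hw : ‖w‖ < r := by simpa using hw
    have hr : 0 < r := by positivity
    refine (hq k w).trans ?_
    have him : |w.im| ≤ r := (Complex.abs_im_le_norm w).trans hw.le
    -- On a bounded disc `‖w - k‖` grows like `|k|`; only a half power of that is kept, so that the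
    -- majorant is the series already summed.
    have hker : (1 + ‖w - k‖)⁻¹ ≤ (1 + r) * (√(1 + |(k : ℝ)|))⁻¹ := by
      have h1 : 1 + |(k : ℝ)| ≤ (1 + r) * (1 + ‖w - k‖) := by
        have h2 := norm_le_norm_add_norm_sub w (k : ℂ)
        rw [Complex.norm_intCast] at h2
        nlinarith [norm_nonneg (w - k), norm_nonneg w]
      have h3 : √(1 + |(k : ℝ)|) ≤ 1 + |(k : ℝ)| := by
        rw [Real.sqrt_le_left (by positivity)]
        nlinarith [abs_nonneg (k : ℝ)]
      have h4 : 0 < √(1 + |(k : ℝ)|) := Real.sqrt_pos.2 (by positivity)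
      rw [← one_div, ← div_eq_mul_inv, div_le_div_iff₀ (by positivity) h4, one_mul]
      exact h3.trans h1
    calc _ ≤ 2 * C * M * Real.exp (Real.pi * r) *
        ((1 + |(k : ℝ)|)⁻¹ * ((1 + r) * (√(1 + |(k : ℝ)|))⁻¹)) := by
          rw [mul_inv]
          gcongr
      _ = _ := by rw [mul_inv]; ring
  set h : ℂ → E := fun w => G w - csinc w • G 0
  have hh : Differentiable ℂ h := hG.sub (differentiable_csinc.smul_const _)
  have hhd : Differentiable ℂ (dslope h 0) := fun w =>
    ((Complex.differentiableOn_dslope univ_mem).2 hh.differentiableOn).differentiableAt univ_mem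
  have hcs (w : ℂ) : ‖csinc w‖ ≤ C * Real.exp (Real.pi * |w.im|) :=
    (hC w).trans (div_le_self (by positivity) (by linarith [norm_nonneg w]))
  obtain ⟨K, hK0, hK⟩ := exists_norm_dslope_le hh (B := M + C * M) fun w => by
    calc ‖h w‖ ≤ ‖G w‖ + ‖csinc w • G 0‖ := norm_sub_le _ _
      _ ≤ M * Real.exp (Real.pi * |w.im|) + C * Real.exp (Real.pi * |w.im|) * M := by
        rw [norm_smul]
        gcongr
        exacts [hM w, hcs w, by simpa using hGk 0]
      _ = _ := by ring
  have hzero : ∀ w, dslope h 0 w - csinc w • deriv G 0 - Q w = 0 := by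
    refine eq_zero_of_vanish_on_int
      (A := K + C * ‖deriv G 0‖ + 2 * C * M * S)
      ((hhd.sub (differentiable_csinc.smul_const _)).sub hQd) ?_ ?_
    -- Only the term `j = k` of the series survives at `w = k`. At `k = 0` it is zero, and the
    -- divided difference equals `G' 0` because sinc is even and so has derivative zero at the
    -- origin.
    · intro k
      have hQk : Q k = (k : ℂ)⁻¹ • G k := by
        have : Q k = q k k := by
          refine tsum_eq_single k fun j hj => ?_
          have : csinc ((k : ℂ) - j) = 0 := by
            rw [← Int.cast_sub]
            exact csinc_intCast (sub_ne_zero.2 hj.symm)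
          simp [q, this]
        rw [this]
        simp [q, csinc_zero]
      rcases eq_or_ne k 0 with rfl | hk
      · rw [hQk]
        have hd : deriv h 0 = deriv G 0 := by
          rw [deriv_fun_sub hG.differentiableAt
            (differentiable_csinc.smul_const _).differentiableAt,
            deriv_smul_const differentiable_csinc.differentiableAt, deriv_csinc_zero]
          simp
        simp [csinc_zero, hd]
      · have hk' : (k : ℂ) ≠ 0 := by exact_mod_cast hk
        rw [hQk, csinc_intCast hk, dslope_of_ne _ hk']
        simp [slope, h, csinc_intCast hk, csinc_zero]
    · intro w
      have hs1 : √(1 + ‖w‖) ≤ 1 + ‖w‖ := by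
        rw [Real.sqrt_le_left (by positivity)]
        nlinarith [norm_nonneg w]
      have hs0 : 0 < √(1 + ‖w‖) := Real.sqrt_pos.2 (by positivity)
      have hQb : ‖Q w‖ ≤ 2 * C * M * Real.exp (Real.pi * |w.im|) * (S / √(1 + ‖w‖)) := by
        calc ‖Q w‖ ≤ ∑' k, ‖q k w‖ := norm_tsum_le_tsum_norm (hqs w)
          _ ≤ ∑' k : ℤ, 2 * C * M * Real.exp (Real.pi * |w.im|) *
              ((1 + |(k : ℝ)|) * (1 + ‖w - k‖))⁻¹ :=
            (hqs w).tsum_le_tsum (fun k => hq k w) ((hS w).1.mul_left _)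
          _ ≤ _ := by
            rw [tsum_mul_left]
            gcongr
            exact (hS w).2
      calc ‖dslope h 0 w - csinc w • deriv G 0 - Q w‖
          ≤ ‖dslope h 0 w‖ + ‖csinc w • deriv G 0‖ + ‖Q w‖ :=
            (norm_sub_le _ _).trans (add_le_add_left (norm_sub_le _ _) _)
        _ ≤ K * Real.exp (Real.pi * |w.im|) / √(1 + ‖w‖) +
            C * Real.exp (Real.pi * |w.im|) / √(1 + ‖w‖) * ‖deriv G 0‖ +
            2 * C * M * Real.exp (Real.pi * |w.im|) * (S / √(1 + ‖w‖)) := by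
          rw [norm_smul]
          gcongr
          · exact (hK w).trans (by gcongr)
          · exact (hC w).trans (by gcongr)
        _ = _ := by ring
  refine ⟨(hqs w).of_norm, ?_⟩
  change G w = (w * csinc w) • deriv G 0 + csinc w • G 0 + w • Q w
  have h1 : dslope h 0 w = csinc w • deriv G 0 + Q w := by
    rw [← sub_eq_zero, ← hzero w]
    abel
  have h2 := sub_smul_dslope h 0 w
  rw [sub_zero, h1] at h2
  have h3 : h 0 = 0 := by simp [h, csinc_zero]
  rw [h3, sub_zero, smul_add, smul_smul] at h2
  have h4 : G w = h w + csinc w • G 0 := by simp [h]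
  rw [h4, ← h2]
  abel

end Sampling

/-! ### The exponential series on the Bernstein space -/

namespace UnboundedOp

variable {E : Type*} [NormedAddCommGroup E] [NormedSpace ℂ E]

theorem hasGenerator_iter (T : IsometryGroup E) (f : smoothDomain T.generator) (k : ℕ) :
    T.HasGenerator (iter T.generator k f) (iter T.generator (k + 1) f) :=
  T.generator_spec ⟨iter T.generator k f, (mem_pow_domain f.2 (k + 1)).2⟩

theorem norm_expTerm_le {D : E →ₗ.[ℂ] E} {σ : ℝ} {f : E} (hf : f ∈ bernsteinSpace D σ) (z : ℂ)
    (r : ℕ) : ‖expTerm D z ⟨f, bernsteinSpace_subset hf⟩ r‖ ≤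
      ((‖z‖ * σ) ^ r / r.factorial) * ‖f‖ := by
  obtain ⟨h, hb⟩ := hf
  rw [expTerm, norm_smul, norm_div, norm_pow, Complex.norm_natCast]
  calc _ ≤ ‖z‖ ^ r / r.factorial * (σ ^ r * ‖f‖) := by gcongr; exact hb r
    _ = _ := by rw [mul_pow]; ring

theorem summable_expTerm [CompleteSpace E] {D : E →ₗ.[ℂ] E} {σ : ℝ} {f : E}
    (hf : f ∈ bernsteinSpace D σ) (z : ℂ) :
    Summable (expTerm D z ⟨f, bernsteinSpace_subset hf⟩) :=
  Summable.of_norm_bounded ((Real.summable_pow_div_factorial (‖z‖ * σ)).mul_right ‖f‖)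
    (norm_expTerm_le hf z)

theorem norm_cexp_le {D : E →ₗ.[ℂ] E} {σ : ℝ} {f : E} (hf : f ∈ bernsteinSpace D σ) (z : ℂ) :
    ‖cexp D z ⟨f, bernsteinSpace_subset hf⟩‖ ≤ ‖f‖ * Real.exp (σ * ‖z‖) := by
  refine tsum_of_norm_bounded (f := expTerm D z ⟨f, bernsteinSpace_subset hf⟩) ?_
    (norm_expTerm_le hf z)
  have h := NormedSpace.expSeries_div_hasSum_exp (‖z‖ * σ)
  rw [← Real.exp_eq_exp_ℝ] at h
  rw [mul_comm ‖f‖, mul_comm σ]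
  exact h.mul_right ‖f‖

theorem differentiable_cexp [CompleteSpace E] {D : E →ₗ.[ℂ] E} {σ : ℝ} (hσ : 0 ≤ σ) {f : E}
    (hf : f ∈ bernsteinSpace D σ) :
    Differentiable ℂ fun z => cexp D z ⟨f, bernsteinSpace_subset hf⟩ := by
  intro z₀
  have hmem : Metric.ball (0 : ℂ) (‖z₀‖ + 1) ∈ 𝓝 z₀ := Metric.isOpen_ball.mem_nhds (by simp)
  refine DifferentiableOn.differentiableAt (s := Metric.ball (0 : ℂ) (‖z₀‖ + 1)) ?_ hmem
  refine Complex.differentiableOn_tsum_of_summable_norm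
    ((Real.summable_pow_div_factorial ((‖z₀‖ + 1) * σ)).mul_right ‖f‖)
    (F := fun r z => expTerm D z ⟨f, bernsteinSpace_subset hf⟩ r) ?_ Metric.isOpen_ball ?_
  · intro r
    unfold expTerm
    fun_prop
  · intro r w hw
    have hw : ‖w‖ < ‖z₀‖ + 1 := by simpa using hw
    refine (norm_expTerm_le hf w r).trans ?_
    gcongr

end UnboundedOp

/-! ### Taylor remainder of an orbit -/

namespace IsometryGroup

variable {E : Type*} [NormedAddCommGroup E] [NormedSpace ℂ E]

/-- By the group law, the difference quotient at `t` is `T t` applied to the one at `0`. -/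
theorem HasGenerator.hasDerivAt {T : IsometryGroup E} {f g : E} (h : T.HasGenerator f g) (t : ℝ) :
    HasDerivAt (fun t : ℝ => T.toFun t f) (T.toFun t g) t := by
  rw [hasDerivAt_iff_tendsto_slope_zero]
  refine (((T.toFun t).continuous.tendsto g).comp h).congr fun s => ?_
  rw [Function.comp_apply, map_smul, map_sub, T.map_add, ← Complex.ofReal_inv, Complex.coe_smul]
  rfl

/-- Differentiating the remainder of order `n + 1` at `a r` gives `ε` times the remainder of order
`n` at `a (r + 1)`, so induction and the mean value inequality apply. The sign `ε` covers negative
times, since that inequality runs over `[0, t]`. -/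
theorem norm_orbit_sub_sum_le (T : IsometryGroup E) {a : ℕ → E}
    (ha : ∀ r, T.HasGenerator (a r) (a (r + 1))) {σ M : ℝ} (hM : ∀ r, ‖a r‖ ≤ σ ^ r * M)
    {ε : ℝ} (hε : |ε| = 1) (n r : ℕ) {t : ℝ} (ht : 0 ≤ t) :
    ‖T.toFun (ε * t) (a r) - ∑ s ∈ Finset.range n, ((ε * t) ^ s / s.factorial : ℝ) • a (r + s)‖ ≤
      t ^ n / n.factorial * (σ ^ (r + n) * M) := by
  induction n generalizing r t with
  | zero => simpa [T.norm_map] using hM r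
  | succ n ih =>
    have hd (s : ℕ) (x : ℝ) : HasDerivAt (fun t : ℝ => (ε * t) ^ (s + 1) / (s + 1).factorial)
        (ε * ((ε * x) ^ s / s.factorial)) x := by
      have h := (((hasDerivAt_id x).const_mul ε).pow (s + 1)).div_const ((s + 1).factorial : ℝ)
      refine h.congr_deriv ?_
      rw [Nat.factorial_succ]
      have : (s.factorial : ℝ) ≠ 0 := by positivity
      have : (s : ℝ) + 1 ≠ 0 := by positivity
      push_cast
      simp only [id]
      field_simp
    have hderiv (x : ℝ) : HasDerivAt (fun t : ℝ => T.toFun (ε * t) (a r) -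
        ∑ s ∈ Finset.range (n + 1), ((ε * t) ^ s / s.factorial : ℝ) • a (r + s))
        (ε • (T.toFun (ε * x) (a (r + 1)) -
        ∑ s ∈ Finset.range n, ((ε * x) ^ s / s.factorial : ℝ) • a (r + 1 + s))) x := by
      rw [smul_sub]
      refine HasDerivAt.fun_sub ?_ ?_
      · have h1 : HasDerivAt (fun t : ℝ => ε * t) ε x := by
          simpa using (hasDerivAt_id x).const_mul ε
        exact ((ha r).hasDerivAt (ε * x)).scomp x h1
      · simp only [Finset.sum_range_succ']
        rw [Finset.smul_sum]
        have h2 : HasDerivAt (fun t : ℝ => ∑ s ∈ Finset.range n,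
            ((ε * t) ^ (s + 1) / (s + 1).factorial : ℝ) • a (r + (s + 1)))
            (∑ s ∈ Finset.range n, ε • ((ε * x) ^ s / s.factorial : ℝ) • a (r + 1 + s)) x := by
          refine HasDerivAt.fun_sum fun s _ => ?_
          rw [smul_smul, show r + 1 + s = r + (s + 1) by ring]
          exact (hd s x).smul_const _
        simpa using h2.add_const (((ε * 1) ^ 0 / (Nat.factorial 0) : ℝ) • a (r + 0))
    refine image_norm_le_of_norm_deriv_right_le_deriv_boundary (a := 0) (b := t)
      (B := fun t => t ^ (n + 1) / (n + 1).factorial * (σ ^ (r + (n + 1)) * M))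
      (B' := fun t => t ^ n / n.factorial * (σ ^ (r + (n + 1)) * M))
      (fun x _ => (hderiv x).continuousAt.continuousWithinAt)
      (fun x _ => (hderiv x).hasDerivWithinAt) ?_ ?_ ?_ (Set.right_mem_Icc.2 ht)
    · simp [Finset.sum_range_succ', T.map_zero]
    · intro x
      have h := (((hasDerivAt_pow (n + 1) x)).div_const ((n + 1).factorial : ℝ)).mul_const
        (σ ^ (r + (n + 1)) * M)
      refine h.congr_deriv ?_
      rw [Nat.factorial_succ]
      have : (n.factorial : ℝ) ≠ 0 := by positivity
      have : (n : ℝ) + 1 ≠ 0 := by positivity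
      push_cast
      field_simp
    · intro x hx
      rw [norm_smul, Real.norm_eq_abs, hε, one_mul]
      refine (ih (r + 1) hx.1).trans_eq ?_
      rw [show r + 1 + n = r + (n + 1) by ring]

end IsometryGroup

/-! ### Agreement with the group and the Phragmén–Lindelöf bound -/

namespace UnboundedOp

variable {E : Type*} [NormedAddCommGroup E] [NormedSpace ℂ E]

theorem cexp_ofReal [CompleteSpace E] (T : IsometryGroup E) {σ : ℝ} {f : E}
    (hf : f ∈ bernsteinSpace T.generator σ) (t : ℝ) :
    cexp T.generator (t : ℂ) ⟨f, bernsteinSpace_subset hf⟩ = T.toFun t f := by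
  obtain ⟨ε, hε, het⟩ : ∃ ε : ℝ, |ε| = 1 ∧ ε * |t| = t := by
    rcases le_total 0 t with h | h
    · exact ⟨1, by simp, by simp [abs_of_nonneg h]⟩
    · exact ⟨-1, by simp, by simp [abs_of_nonpos h]⟩
  refine tendsto_nhds_unique (summable_expTerm hf (t : ℂ)).hasSum.tendsto_sum_nat ?_
  rw [tendsto_iff_norm_sub_tendsto_zero]
  have hlim : Tendsto (fun n : ℕ => (|t| * σ) ^ n / n.factorial * ‖f‖) atTop (𝓝 0) := by
    simpa using (Real.summable_pow_div_factorial (|t| * σ)).tendsto_atTop_zero.mul_const ‖f‖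
  refine squeeze_zero (fun n => norm_nonneg _) (fun n => ?_) hlim
  have h := T.norm_orbit_sub_sum_le (a := fun r => iter T.generator r ⟨f, hf.1⟩)
    (hasGenerator_iter T _) hf.2 hε n 0 (abs_nonneg t)
  rw [het, norm_sub_rev] at h
  refine (le_of_eq ?_).trans (h.trans_eq ?_)
  · congr 2
    refine Finset.sum_congr rfl fun s _ => ?_
    rw [expTerm, zero_add, ← Complex.coe_smul]
    push_cast
    rfl
  · rw [zero_add, mul_pow]
    ring

/-- The rotation `z ↦ ε i z` carries the right half-plane to the upper or lower one. The function
`exp (-σ z) • F (ε i z)` has norm `‖f‖` on the imaginary axis, where the group is isometric, and at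
most `‖f‖` on the positive real axis by the crude bound `norm_cexp_le`; Phragmén–Lindelöf extends
this to the half-plane. -/
theorem norm_cexp_mul_I_le [CompleteSpace E] (T : IsometryGroup E) {σ : ℝ} (hσ : 0 ≤ σ) {f : E}
    (hf : f ∈ bernsteinSpace T.generator σ) {ε : ℝ} (hε : |ε| = 1) {z : ℂ} (hz : 0 ≤ z.re) :
    ‖cexp T.generator (ε * z * Complex.I) ⟨f, bernsteinSpace_subset hf⟩‖ ≤
      ‖f‖ * Real.exp (σ * z.re) := by
  set F : ℂ → E := fun z => cexp T.generator z ⟨f, bernsteinSpace_subset hf⟩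
  have hF : Differentiable ℂ F := differentiable_cexp hσ hf
  have hnorm (z : ℂ) : ‖(ε : ℂ) * z * Complex.I‖ = ‖z‖ := by
    simp [hε]
  have hexp (z : ℂ) : ‖Complex.exp (-(σ * z))‖ = Real.exp (-(σ * z.re)) := by
    rw [Complex.norm_exp]
    simp
  have key := PhragmenLindelof.right_half_plane_of_bounded_on_real (C := ‖f‖) (z := z)
    (f := fun z => Complex.exp (-(σ * z)) • F (ε * z * Complex.I)) ?_ ?_ ?_ ?_ hz
  · rw [norm_smul, hexp, Real.exp_neg, inv_mul_le_iff₀ (Real.exp_pos _)] at key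
    rwa [mul_comm ‖f‖]
  · refine Differentiable.diffContOnCl ?_
    refine Differentiable.smul (by fun_prop) (hF.comp (by fun_prop))
  -- Growth of order 1, below the critical order 2 required here.
  · refine ⟨1, by norm_num, σ, ?_⟩
    refine Asymptotics.IsBigO.of_bound ‖f‖ ?_
    refine Eventually.filter_mono inf_le_right ?_
    rw [eventually_principal]
    intro z hz
    have hz : 0 < z.re := hz
    rw [norm_smul, hexp, Real.rpow_one, Real.norm_of_nonneg (Real.exp_pos _).le]
    have h1 := norm_cexp_le hf (ε * z * Complex.I)
    rw [hnorm] at h1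
    have h2 : Real.exp (-(σ * z.re)) ≤ 1 := Real.exp_le_one_iff.2 (by nlinarith)
    calc _ ≤ 1 * (‖f‖ * Real.exp (σ * ‖z‖)) := by gcongr
      _ = _ := one_mul _
  · refine isBoundedUnder_of_eventually_le (a := ‖f‖) ?_
    filter_upwards [eventually_ge_atTop 0] with x hx
    have h1 := norm_cexp_le hf (ε * x * Complex.I)
    rw [hnorm, Complex.norm_real, Real.norm_of_nonneg hx] at h1
    rw [norm_smul, hexp, Complex.ofReal_re, Real.exp_neg, inv_mul_le_iff₀ (Real.exp_pos _)]
    rwa [mul_comm (Real.exp _)]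
  · intro x
    have h1 : (ε : ℂ) * (x * Complex.I) * Complex.I = ((-(ε * x) : ℝ) : ℂ) := by
      push_cast
      linear_combination (ε * x : ℂ) * Complex.I_mul_I
    rw [norm_smul, hexp, h1]
    simp only [F]
    rw [cexp_ofReal T hf, T.norm_map]
    simp

theorem norm_cexp_le_exp_abs_im [CompleteSpace E] (T : IsometryGroup E) {σ : ℝ} (hσ : 0 ≤ σ)
    {f : E} (hf : f ∈ bernsteinSpace T.generator σ) (z : ℂ) :
    ‖cexp T.generator z ⟨f, bernsteinSpace_subset hf⟩‖ ≤ ‖f‖ * Real.exp (σ * |z.im|) := by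
  rcases le_total 0 z.im with h | h
  · have := norm_cexp_mul_I_le T hσ hf (ε := 1) (by simp) (z := -(z * Complex.I)) (by simpa using h)
    have e : ((1 : ℝ) : ℂ) * (-(z * Complex.I)) * Complex.I = z := by
      push_cast
      linear_combination (-z) * Complex.I_mul_I
    rw [e] at this
    simpa [abs_of_nonneg h] using this
  · have := norm_cexp_mul_I_le T hσ hf (ε := -1) (by simp) (z := z * Complex.I) (by simpa using h)
    have e : ((-1 : ℝ) : ℂ) * (z * Complex.I) * Complex.I = z := by
      push_cast
      linear_combination (-z) * Complex.I_mul_I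
    rw [e] at this
    simpa [abs_of_nonpos h] using this

/-- The complex derivative can be read off along the real axis, where the function is the orbit. -/
theorem deriv_cexp_zero [CompleteSpace E] (T : IsometryGroup E) {σ : ℝ} (hσ : 0 ≤ σ)
    {f : E} (hf : f ∈ bernsteinSpace T.generator σ) :
    deriv (fun z => cexp T.generator z ⟨f, bernsteinSpace_subset hf⟩) 0 =
      T.generator ⟨f, mem_domain (bernsteinSpace_subset hf)⟩ := by
  have h1 := ((differentiable_cexp hσ hf).differentiableAt (x := ((0 : ℝ) : ℂ))).hasDerivAt
  have h2 := h1.scomp (0 : ℝ) Complex.ofRealCLM.hasDerivAt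
  simp only [Function.comp_def, Complex.ofRealCLM_apply, cexp_ofReal T hf] at h2
  have h3 := (T.generator_spec ⟨f, mem_domain (bernsteinSpace_subset hf)⟩).hasDerivAt 0
  rw [T.map_zero] at h3
  simpa using h2.unique h3

end UnboundedOp

/-! ### The sampling formula for the group -/

theorem mainTheorem6 {E : Type*} [NormedAddCommGroup E] [NormedSpace ℂ E] [CompleteSpace E]
    (T : IsometryGroup E) (σ : ℝ) (hσ : 0 < σ) (f : E)
    (hf : f ∈ UnboundedOp.bernsteinSpace T.generator σ) :
    -- `z ↦ e^{zD} f` is well defined, entire, and extends the orbit of `f`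
    ((∀ z : ℂ, Summable (UnboundedOp.expTerm T.generator z
          ⟨f, UnboundedOp.bernsteinSpace_subset hf⟩)) ∧
      Differentiable ℂ (fun z : ℂ => UnboundedOp.cexp T.generator z
          ⟨f, UnboundedOp.bernsteinSpace_subset hf⟩) ∧
      ∀ t : ℝ, UnboundedOp.cexp T.generator (t : ℂ)
          ⟨f, UnboundedOp.bernsteinSpace_subset hf⟩ = T.toFun t f) ∧
    -- the sampling formula
    ∀ z : ℂ,
      Summable (fun k : {k : ℤ // k ≠ 0} =>
        (((σ : ℂ) * z / ((k.1 : ℂ) * (Real.pi : ℂ))) *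
          csinc ((σ : ℂ) * z / (Real.pi : ℂ) - (k.1 : ℂ))) •
            T.toFun ((k.1 : ℝ) * Real.pi / σ) f) ∧
      UnboundedOp.cexp T.generator z ⟨f, UnboundedOp.bernsteinSpace_subset hf⟩ =
        (z * csinc ((σ : ℂ) * z / (Real.pi : ℂ))) •
            T.generator ⟨f, UnboundedOp.mem_domain (UnboundedOp.bernsteinSpace_subset hf)⟩ +
          csinc ((σ : ℂ) * z / (Real.pi : ℂ)) • f +
          ∑' k : {k : ℤ // k ≠ 0},
            (((σ : ℂ) * z / ((k.1 : ℂ) * (Real.pi : ℂ))) *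
              csinc ((σ : ℂ) * z / (Real.pi : ℂ) - (k.1 : ℂ))) •
                T.toFun ((k.1 : ℝ) * Real.pi / σ) f := by
  refine ⟨⟨UnboundedOp.summable_expTerm hf, UnboundedOp.differentiable_cexp hσ.le hf,
    UnboundedOp.cexp_ofReal T hf⟩, fun z => ?_⟩
  have hσ' : (σ : ℂ) ≠ 0 := by exact_mod_cast hσ.ne'
  have hpi : (Real.pi : ℂ) ≠ 0 := by exact_mod_cast Real.pi_ne_zero
  set F : ℂ → E := fun z => UnboundedOp.cexp T.generator z
    ⟨f, UnboundedOp.bernsteinSpace_subset hf⟩ with hFdef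
  have hF : Differentiable ℂ F := UnboundedOp.differentiable_cexp hσ.le hf
  -- Scaling by `c` turns type `σ` into type `π` and moves the nodes `k π / σ` to the integers.
  set c : ℂ := Real.pi / σ with hc
  set w : ℂ := (σ : ℂ) * z / (Real.pi : ℂ) with hw
  have hcw : c * w = z := by rw [hc, hw]; field_simp
  have hbound (w : ℂ) : ‖F (c * w)‖ ≤ ‖f‖ * Real.exp (Real.pi * |w.im|) := by
    refine (UnboundedOp.norm_cexp_le_exp_abs_im T hσ.le hf (c * w)).trans_eq ?_
    have : (c * w).im = Real.pi / σ * w.im := by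
      rw [hc, ← Complex.ofReal_div, Complex.im_ofReal_mul]
    rw [this, abs_mul, abs_of_pos (div_pos Real.pi_pos hσ)]
    congr 2
    field_simp
  obtain ⟨hs, heq⟩ := valiron_tschakaloff (G := fun w => F (c * w))
    (hF.comp (differentiable_id.const_mul c)) hbound w
  have hk (k : ℤ) : F (c * k) = T.toFun ((k : ℝ) * Real.pi / σ) f := by
    rw [← UnboundedOp.cexp_ofReal T hf, hFdef, hc]
    congr 1
    push_cast
    ring
  have hterm (k : ℤ) : w • (csinc (w - k) * (k : ℂ)⁻¹) • F (c * k) =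
      (((σ : ℂ) * z / ((k : ℂ) * (Real.pi : ℂ))) * csinc (w - k)) •
        T.toFun ((k : ℝ) * Real.pi / σ) f := by
    rw [hk, smul_smul, hw]
    congr 1
    rw [mul_comm (k : ℂ), ← div_div, div_eq_mul_inv _ (k : ℂ)]
    ring
  have hs' : Summable fun k : ℤ => (((σ : ℂ) * z / ((k : ℂ) * (Real.pi : ℂ))) * csinc (w - k)) •
        T.toFun ((k : ℝ) * Real.pi / σ) f := by
    simpa only [hterm] using hs.const_smul w
  refine ⟨hs'.subtype {k : ℤ | k ≠ 0}, ?_⟩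
  have hsub : ∑' k : {k : ℤ // k ≠ 0}, (((σ : ℂ) * z / ((k.1 : ℂ) * (Real.pi : ℂ))) *
      csinc (w - k.1)) • T.toFun ((k.1 : ℝ) * Real.pi / σ) f =
      w • ∑' k : ℤ, (csinc (w - k) * (k : ℂ)⁻¹) • F (c * k) := by
    rw [← hs.tsum_const_smul w]
    simp only [hterm]
    -- The term at `k = 0` contains a division by zero, hence is zero, and may be dropped.
    refine tsum_subtype_eq_of_support_subset (s := {k : ℤ | k ≠ 0})
      (f := fun k : ℤ => (((σ : ℂ) * z / ((k : ℂ) * (Real.pi : ℂ))) * csinc (w - k)) •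
        T.toFun ((k : ℝ) * Real.pi / σ) f) ?_
    rintro k hk0 rfl
    simp at hk0
  have hd : deriv (fun w => F (c * w)) 0 =
      c • T.generator ⟨f, UnboundedOp.mem_domain (UnboundedOp.bernsteinSpace_subset hf)⟩ := by
    rw [deriv_comp_mul_left, mul_zero, UnboundedOp.deriv_cexp_zero T hσ.le hf]
  have hF0 : F (c * 0) = f := by
    have := hk 0
    simpa [T.map_zero] using this
  have hcoef : w * csinc w * c = z * csinc w := by
    rw [← hcw]
    ring
  rw [hsub]
  change F z = _
  simp only [hd, hF0, hcw, smul_smul, hcoef] at heq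
  exact heq
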